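/- Let $Y$ be a Young diagram, that is, a left-aligned array of finitely many rows of cells whose row lengths $l_1\le l_2\le\dots\le l_m$ (from bottom to top) are nonnegative integers. Say that $Y$ is \emph{Latin} if its cells can be filled with integers so that each row of length $\ell$ is populated by the numbers $1,\dots,\ell$ and the numbers in each column are distinct. Let $a_1<a_2<\dots<a_p$ be the distinct row lengths of $Y$, and for $1\le i\le p$ let $e_i\ge 1$ be the number of rows of length $a_i$. Put $a_0=0$ and $b_i=a_i-a_{i-1}$ for $1\le i\le p$. An \emph{allocation} for $Y$ is a collection of nonnegative integers $z_{ijk}$, for $1\le j,k\le i\le p$, satisfying \begin{align*} &\sum_{k=1}^{i} z_{ijk}=e_ib_j &&\text{for } 1\le j\le i\le p,\\ &\sum_{j=1}^{i} z_{ijk}=e_ib_k &&\text{for } 1\le k\le i\le p,\\ &\sum_{i=\max(j,k)}^{p} z_{ijk}\le b_jb_k &&\text{for } 1\le j,k\le p. \end{align*} Theorem. A Young diagram $Y$ has an allocation if and only if $Y$ is Latin. -/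

import Mathlib

/-- A Latin filling of a Young diagram: the cell in row `r` and column `c` (both counted from `0`)
receives the number `f r c`; a row of length `ℓ` is populated by the numbers `1, …, ℓ`, and the
numbers in each column are distinct. Values of `f` outside the diagram are irrelevant. -/
structure IsLatinFilling (Y : YoungDiagram) (f : ℕ → ℕ → ℕ) : Prop where
  row : ∀ r, Set.BijOn (f r) {c | (r, c) ∈ Y} (Set.Icc 1 (Y.rowLen r))
  col : ∀ c, Set.InjOn (fun r => f r c) {r | (r, c) ∈ Y}

/-- A Young diagram is Latin if it has a Latin filling. -/
def IsLatin (Y : YoungDiagram) : Prop :=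
  ∃ f : ℕ → ℕ → ℕ, IsLatinFilling Y f

/-- The number `p` of distinct entries of a list `w` of row lengths. -/
def numBlocks (w : List ℕ) : ℕ :=
  w.toFinset.card

/-- The distinct entries `a 1 < a 2 < ⋯ < a p` of a list `w` of row lengths, preceded by
`a 0 = 0`. (The value is `0` for indices above `p`.) -/
def blockLen (w : List ℕ) (i : ℕ) : ℕ :=
  (0 :: w.toFinset.sort (· ≤ ·)).getD i 0

/-- The number `e i` of rows of length `a i`, for `1 ≤ i ≤ p`. -/
def blockHeight (w : List ℕ) (i : ℕ) : ℕ :=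
  w.count (blockLen w i)

/-- The width `b i = a i - a (i - 1)` of the `i`-th column block, for `1 ≤ i ≤ p`. -/
def blockWidth (w : List ℕ) (i : ℕ) : ℕ :=
  blockLen w i - blockLen w (i - 1)

/-- An allocation for the Young diagram with row lengths `w`. Only the values `z i j k` with
`1 ≤ j, k ≤ i ≤ p` matter. -/
structure IsAllocation (w : List ℕ) (z : ℕ → ℕ → ℕ → ℕ) : Prop where
  sum_symbols : ∀ i j, 1 ≤ j → j ≤ i → i ≤ numBlocks w →
    ∑ k ∈ Finset.Icc 1 i, z i j k = blockHeight w i * blockWidth w j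
  sum_columns : ∀ i k, 1 ≤ k → k ≤ i → i ≤ numBlocks w →
    ∑ j ∈ Finset.Icc 1 i, z i j k = blockHeight w i * blockWidth w k
  sum_rows : ∀ j k, 1 ≤ j → j ≤ numBlocks w → 1 ≤ k → k ≤ numBlocks w →
    ∑ i ∈ Finset.Icc (max j k) (numBlocks w), z i j k ≤ blockWidth w j * blockWidth w k

/-- The Young diagram with row lengths `w` has an allocation. -/
def HasAllocation (w : List ℕ) : Prop :=
  ∃ z : ℕ → ℕ → ℕ → ℕ, IsAllocation w z

/-!
An allocation is what remains of a Latin filling after amalgamation: `z i j k` counts the cells of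
the block formed by the rows of length `a i` and the columns in `(a (j - 1), a j]` that contain a
number in `(a (k - 1), a k]`. Conversely, an allocation is disentangled by splitting first the row
blocks, then the column blocks and finally the symbol blocks into single rows, columns and symbols.

Each splitting distributes, for a block of `n` lines, an integer matrix `M` over these `n` lines.
Row and column sums of `M` are at most `n` times given capacities, and `M` is a sum of `n`
nonnegative integer matrices respecting the capacities: splitting every line of `M` reduces this to
unit capacities, where `M` is padded to a regular square matrix and decomposed into permutation
matrices by Birkhoff's theorem. Wherever the definition of an allocation asks for an equality, the
total is extremal, so that every part attains its capacity.
-/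

open Finset Matrix

section Decomposition

variable {ι τ A B : Type*} [Fintype A] [Fintype B]

theorem exists_perm_forall_apply_pos [Fintype ι] {M : Matrix ι ι ℕ} {n : ℕ}
    (hn : n ≠ 0) (hrow : ∀ i, ∑ j, M i j = n) (hcol : ∀ j, ∑ i, M i j = n) :
    ∃ σ : Equiv.Perm ι, ∀ i, 0 < M i (σ i) := by
  classical
  have hn' : (n : ℚ) ≠ 0 := Nat.cast_ne_zero.2 hn
  have hM : (n : ℚ)⁻¹ • M.map Nat.cast ∈ doublyStochastic ℚ ι := by
    simp only [mem_doublyStochastic_iff_sum, Matrix.smul_apply, map_apply, smul_eq_mul,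
      ← Finset.mul_sum, ← Nat.cast_sum, hrow, hcol, inv_mul_cancel₀ hn', implies_true, and_true]
    exact fun i j => by positivity
  obtain ⟨w, hw_nonneg, hw_sum, hw⟩ := exists_eq_sum_perm_of_mem_doublyStochastic hM
  obtain ⟨σ, -, hσ⟩ : ∃ σ ∈ univ, (0 : ℚ) < w σ :=
    exists_lt_of_sum_lt (by simp [hw_sum])
  refine ⟨σ, fun i => Nat.pos_of_ne_zero fun h => hσ.not_ge ?_⟩
  calc w σ = w σ * σ.permMatrix ℚ i (σ i) := by simp [Equiv.toPEquiv_apply]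
    _ ≤ ∑ π, w π * π.permMatrix ℚ i (σ i) :=
      single_le_sum (f := fun π => w π * π.permMatrix ℚ i (σ i))
        (fun π _ => mul_nonneg (hw_nonneg π)
          (nonneg_of_mem_doublyStochastic permMatrix_mem_doublyStochastic)) (mem_univ σ)
    _ = 0 := by simpa [h, Matrix.sum_apply] using congr_fun₂ hw i (σ i)

theorem exists_eq_sum_permMatrix [Fintype ι] [DecidableEq ι] (T : Finset τ) (M : Matrix ι ι ℕ)
    (hrow : ∀ i, ∑ j, M i j = #T) (hcol : ∀ j, ∑ i, M i j = #T) :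
    ∃ σ : τ → Equiv.Perm ι, ∑ t ∈ T, (σ t).permMatrix ℕ = M := by
  classical
  induction T using Finset.induction_on generalizing M with
  | empty =>
    refine ⟨fun _ => 1, Matrix.ext fun i j => ?_⟩
    simpa using (sum_eq_zero_iff.1 (hrow i) j (mem_univ j)).symm
  | insert a T ha ih =>
    rw [card_insert_of_notMem ha] at hrow hcol
    obtain ⟨π, hπ⟩ := exists_perm_forall_apply_pos (#T).succ_ne_zero hrow hcol
    have hle : ∀ i j, π.permMatrix ℕ i j ≤ M i j := fun i j => by
      rw [Equiv.Perm.permMatrix, PEquiv.toMatrix_apply]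
      split_ifs with h
      · obtain rfl : π i = j := by simpa [Equiv.toPEquiv_apply] using h
        exact hπ i
      · exact Nat.zero_le _
    have hπ_mem : π.permMatrix ℕ ∈ doublyStochastic ℕ ι := permMatrix_mem_doublyStochastic
    obtain ⟨σ, hσ⟩ := ih (M - π.permMatrix ℕ)
      (fun i => by
        simp only [Matrix.sub_apply]
        rw [sum_tsub_distrib _ fun j _ => hle i j, hrow, sum_row_of_mem_doublyStochastic hπ_mem,
          Nat.add_sub_cancel])
      (fun j => by
        simp only [Matrix.sub_apply]
        rw [sum_tsub_distrib _ fun i _ => hle i j, hcol, sum_col_of_mem_doublyStochastic hπ_mem,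
          Nat.add_sub_cancel])
    refine ⟨Function.update σ a π, ?_⟩
    rw [sum_insert ha, Function.update_self,
      sum_congr rfl fun t ht => by rw [Function.update_of_ne (ne_of_mem_of_not_mem ht ha)], hσ]
    exact Matrix.ext fun i j => Nat.add_sub_cancel' (hle i j)

theorem exists_decomposition_of_sum_le_card (T : Finset τ) (M : Matrix A B ℕ)
    (hrow : ∀ a, ∑ b, M a b ≤ #T) (hcol : ∀ b, ∑ a, M a b ≤ #T) :
    ∃ D : τ → Matrix A B ℕ, ∑ t ∈ T, D t = M ∧
      (∀ t a, ∑ b, D t a b ≤ 1) ∧ ∀ t b, ∑ a, D t a b ≤ 1 := by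
  classical
  -- The blocks around `M` make every line sum equal to `#T`; the summands of `M` are then the upper
  -- right blocks of permutation matrices.
  obtain ⟨σ, hσ⟩ := exists_eq_sum_permMatrix T
    (fromBlocks (diagonal fun a => #T - ∑ b, M a b) M Mᵀ (diagonal fun b => #T - ∑ a, M a b))
    (by rintro (a | b) <;> simp [diagonal_apply, hrow, hcol])
    (by rintro (a | b) <;> simp [diagonal_apply, hrow, hcol])
  have hmem (t : τ) : (σ t).permMatrix ℕ ∈ doublyStochastic ℕ (A ⊕ B) :=
    permMatrix_mem_doublyStochastic
  refine ⟨fun t => ((σ t).permMatrix ℕ).toBlocks₁₂, ?_, fun t a => ?_, fun t b => ?_⟩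
  · ext a b
    have hab := congr_fun₂ hσ (Sum.inl a) (Sum.inr b)
    rw [Matrix.sum_apply, fromBlocks_apply₁₂] at hab
    rwa [Matrix.sum_apply]
  · rw [← sum_row_of_mem_doublyStochastic (hmem t) (Sum.inl a), Fintype.sum_sum_type]
    exact Nat.le_add_left _ _
  · rw [← sum_col_of_mem_doublyStochastic (hmem t) (Sum.inr b), Fintype.sum_sum_type]
    exact Nat.le_add_right _ _

theorem exists_split_of_sum_le_mul {n u : ℕ} (f : B → ℕ) (hf : ∑ b, f b ≤ u * n) :
    ∃ g : Fin u → B → ℕ, (∀ b, ∑ i, g i b = f b) ∧ ∀ i, ∑ b, g i b ≤ n := by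
  classical
  obtain ⟨φ⟩ : Nonempty ((Σ b, Fin (f b)) ↪ Fin u × Fin n) :=
    Function.Embedding.nonempty_of_card_le (by simpa using hf)
  refine ⟨fun i b => #{t : Fin (f b) | (φ ⟨b, t⟩).1 = i}, fun b => ?_, fun i => ?_⟩
  · simpa using (card_eq_sum_card_fiberwise (s := univ) (t := univ)
      (f := fun t : Fin (f b) => (φ ⟨b, t⟩).1) (by simp)).symm
  · rw [← card_sigma]
    refine (card_le_card_of_injOn (t := (univ : Finset (Fin n))) (fun e => (φ e).2) (by simp)
      fun e he e' he' h => φ.injective (Prod.ext ?_ h)).trans_eq (by simp)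
    simp only [coe_sigma, Set.mem_sigma_iff, coe_filter, mem_univ, true_and] at he he'
    exact he.2.trans he'.2.symm

theorem exists_decomposition_of_row_sum_le (T : Finset τ) (M : Matrix A B ℕ) (u : A → ℕ)
    (hrow : ∀ a, ∑ b, M a b ≤ u a * #T) (hcol : ∀ b, ∑ a, M a b ≤ #T) :
    ∃ D : τ → Matrix A B ℕ, ∑ t ∈ T, D t = M ∧
      (∀ t a, ∑ b, D t a b ≤ u a) ∧ ∀ t b, ∑ a, D t a b ≤ 1 := by
  -- Split row `a` into `u a` rows of sum at most `#T`, decompose, and glue the rows back together.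
  choose g hgM hg using fun a => exists_split_of_sum_le_mul (M a) (hrow a)
  obtain ⟨D, hDM, hDrow, hDcol⟩ := exists_decomposition_of_sum_le_card T
    (of fun (q : Σ a, Fin (u a)) b => g q.1 q.2 b) (fun q => hg q.1 q.2)
    (fun b => by simpa [Fintype.sum_sigma, hgM] using hcol b)
  refine ⟨fun t => of fun a b => ∑ i, D t ⟨a, i⟩ b, ?_, fun t a => ?_, fun t b => ?_⟩
  · ext a b
    simp_rw [← hgM, Matrix.sum_apply, of_apply]
    rw [sum_comm]
    refine sum_congr rfl fun i _ => ?_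
    simpa [Matrix.sum_apply] using congr_fun₂ hDM ⟨a, i⟩ b
  · simp only [of_apply]
    rw [sum_comm]
    simpa using sum_le_card_nsmul univ _ 1 fun i _ => hDrow t ⟨a, i⟩
  · simpa [Fintype.sum_sigma] using hDcol t b

theorem exists_decomposition_of_line_sum_le (T : Finset τ) (M : Matrix A B ℕ) (u : A → ℕ)
    (v : B → ℕ) (hrow : ∀ a, ∑ b, M a b ≤ u a * #T) (hcol : ∀ b, ∑ a, M a b ≤ v b * #T) :
    ∃ D : τ → Matrix A B ℕ, ∑ t ∈ T, D t = M ∧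
      (∀ t a, ∑ b, D t a b ≤ u a) ∧ ∀ t b, ∑ a, D t a b ≤ v b := by
  choose g hgM hg using fun b => exists_split_of_sum_le_mul (Mᵀ b) (hcol b)
  obtain ⟨D, hDM, hDrow, hDcol⟩ := exists_decomposition_of_row_sum_le T
    (of fun a (q : Σ b, Fin (v b)) => g q.1 q.2 a) u
    (fun a => by simpa [Fintype.sum_sigma, hgM] using hrow a) (fun q => hg q.1 q.2)
  refine ⟨fun t => of fun a b => ∑ i, D t a ⟨b, i⟩, ?_, fun t a => ?_, fun t b => ?_⟩
  · ext a b
    rw [← transpose_apply M, ← hgM]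
    simp_rw [Matrix.sum_apply, of_apply]
    rw [sum_comm]
    refine sum_congr rfl fun i _ => ?_
    simpa [Matrix.sum_apply] using congr_fun₂ hDM a ⟨b, i⟩
  · simpa [Fintype.sum_sigma] using hDrow t a
  · simp only [of_apply]
    rw [sum_comm]
    simpa using sum_le_card_nsmul univ _ 1 fun i _ => hDcol t ⟨b, i⟩

end Decomposition

section Outline

variable {I J K R C S A B : Type*}

theorem exists_refinement [Fintype A] [Fintype B] [Fintype R] [DecidableEq I] (ρ : R → I)
    (M : I → A → B → ℕ) (u : I → A → ℕ) (v : I → B → ℕ)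
    (hrow : ∀ i a, ∑ b, M i a b ≤ u i a * #{r | ρ r = i})
    (hcol : ∀ i b, ∑ a, M i a b ≤ v i b * #{r | ρ r = i}) :
    ∃ D : R → A → B → ℕ, (∀ i a b, ∑ r with ρ r = i, D r a b = M i a b) ∧
      (∀ r a, ∑ b, D r a b ≤ u (ρ r) a) ∧ ∀ r b, ∑ a, D r a b ≤ v (ρ r) b := by
  choose D hDM hDrow hDcol using fun i =>
    exists_decomposition_of_line_sum_le {r | ρ r = i} (M i) (u i) (v i) (hrow i) (hcol i)
  refine ⟨fun r => D (ρ r) r, fun i a b => ?_, fun r => hDrow _ r, fun r => hDcol _ r⟩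
  rw [← hDM i, Matrix.sum_apply]
  exact sum_congr rfl fun r hr => by rw [← (mem_filter.1 hr).2]

theorem eq_of_le_of_sum_fiber_eq [Fintype R] [DecidableEq I] {ρ : R → I} {g : R → ℕ} {u : I → ℕ}
    (hle : ∀ r, g r ≤ u (ρ r)) (hsum : ∀ i, ∑ r with ρ r = i, g r = u i * #{r | ρ r = i}) (r : R) :
    g r = u (ρ r) := by
  have hfiber : ∑ r' with ρ r' = ρ r, g r' = ∑ r' with ρ r' = ρ r, u (ρ r) := by
    rw [hsum, sum_const, smul_eq_mul, mul_comm]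
  exact (sum_eq_sum_iff_of_le fun r' hr' => (mem_filter.1 hr').2 ▸ hle r').1 hfiber r (by simp)

/-- An amalgamation of an array of cells `R × C` filled with symbols from `S`, in which a symbol
occurs at most once per row and per column. Blocks of rows, columns and symbols are indexed by `I`,
`J`, `K` and have sizes `e`, `b`, `c`, and `z i j k` counts the cells of the block `(i, j)` whose
symbol lies in the block `k`. The `0`-`1` functions `d` and `d'` say which columns and which symbols
the rows of a block use; allocations are the case of equal staircases `d` and `d'`. -/
structure IsOutline [Fintype I] [Fintype J] [Fintype K] (e : I → ℕ) (b : J → ℕ) (c : K → ℕ)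
    (d : I → J → ℕ) (d' : I → K → ℕ) (z : I → J → K → ℕ) : Prop where
  sum_symbols : ∀ i j, ∑ k, z i j k = e i * b j * d i j
  sum_columns : ∀ i k, ∑ j, z i j k = e i * c k * d' i k
  sum_rows : ∀ j k, ∑ i, z i j k ≤ b j * c k

namespace IsOutline

variable [Fintype I] [Fintype J] [Fintype K] {e : I → ℕ} {b : J → ℕ} {c : K → ℕ}
  {d : I → J → ℕ} {d' : I → K → ℕ} {z : I → J → K → ℕ}

theorem swap (hz : IsOutline e b c d d' z) : IsOutline e c b d' d fun i k j => z i j k where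
  sum_symbols := hz.sum_columns
  sum_columns := hz.sum_symbols
  sum_rows k j := (hz.sum_rows j k).trans_eq (mul_comm _ _)

theorem eq_zero_of_column_eq_zero (hz : IsOutline e b c d d' z) {i : I} {j : J} (h : d i j = 0)
    (k : K) : z i j k = 0 :=
  sum_eq_zero_iff.1 ((hz.sum_symbols i j).trans (by rw [h, mul_zero])) k (mem_univ k)

theorem eq_zero_of_symbol_eq_zero (hz : IsOutline e b c d d' z) {i : I} {k : K} (h : d' i k = 0)
    (j : J) : z i j k = 0 :=
  hz.swap.eq_zero_of_column_eq_zero h j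

theorem mergeRows [Fintype R] [DecidableEq I] {ρ : R → I} {y : R → J → K → ℕ}
    (hy : IsOutline 1 b c (d ∘ ρ) (d' ∘ ρ) y) :
    IsOutline (fun i => #{r | ρ r = i}) b c d d' fun i j k => ∑ r with ρ r = i, y r j k where
  sum_symbols i j := by
    rw [sum_comm, mul_assoc, ← smul_eq_mul]
    refine sum_eq_card_nsmul fun r hr => ?_
    rw [hy.sum_symbols, ← (mem_filter.1 hr).2, Pi.one_apply, one_mul, Function.comp_apply]
  sum_columns i k := by
    rw [sum_comm, mul_assoc, ← smul_eq_mul]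
    refine sum_eq_card_nsmul fun r hr => ?_
    rw [hy.sum_columns, ← (mem_filter.1 hr).2, Pi.one_apply, one_mul, Function.comp_apply]
  sum_rows j k := by
    rw [sum_fiberwise]
    exact hy.sum_rows j k

theorem mergeColumns [Fintype C] [DecidableEq J] {κ : C → J} {y : I → C → K → ℕ}
    (hy : IsOutline e 1 c (fun i q => d i (κ q)) d' y) :
    IsOutline e (fun j => #{q | κ q = j}) c d d' fun i j k => ∑ q with κ q = j, y i q k where
  sum_symbols i j := by
    rw [sum_comm, mul_comm (e i), mul_assoc, ← smul_eq_mul]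
    refine sum_eq_card_nsmul fun q hq => ?_
    rw [hy.sum_symbols, ← (mem_filter.1 hq).2, Pi.one_apply, mul_one]
  sum_columns i k := by
    rw [sum_fiberwise]
    exact hy.sum_columns i k
  sum_rows j k := by
    rw [sum_comm, ← smul_eq_mul]
    exact sum_le_card_nsmul _ _ _ fun q _ => (hy.sum_rows q k).trans_eq (one_mul _)

theorem exists_splitRows [Fintype R] [DecidableEq I] {ρ : R → I}
    (hz : IsOutline (fun i => #{r | ρ r = i}) b c d d' z) :
    ∃ y, IsOutline 1 b c (d ∘ ρ) (d' ∘ ρ) y := by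
  have hrow : ∀ i j, ∑ k, z i j k = b j * d i j * #{r | ρ r = i} := fun i j => by
    rw [hz.sum_symbols]; ring
  have hcol : ∀ i k, ∑ j, z i j k = c k * d' i k * #{r | ρ r = i} := fun i k => by
    rw [hz.sum_columns]; ring
  obtain ⟨D, hDz, hDrow, hDcol⟩ := exists_refinement ρ z _ _
    (fun i j => (hrow i j).le) (fun i k => (hcol i k).le)
  refine ⟨D, fun r j => ?_, fun r k => ?_, fun j k => ?_⟩
  · rw [Pi.one_apply, one_mul]
    refine eq_of_le_of_sum_fiber_eq (u := fun i => b j * d i j) (fun r => hDrow r j) (fun i => ?_) r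
    simp_rw [← hrow, ← hDz, sum_comm (t := univ)]
  · rw [Pi.one_apply, one_mul]
    refine eq_of_le_of_sum_fiber_eq (u := fun i => c k * d' i k) (fun r => hDcol r k)
      (fun i => ?_) r
    simp_rw [← hcol, ← hDz, sum_comm (t := univ)]
  · rw [← sum_fiberwise univ ρ]
    simpa only [hDz] using hz.sum_rows j k

theorem exists_splitColumns [Fintype C] [DecidableEq J] {κ : C → J}
    (hz : IsOutline e (fun j => #{q | κ q = j}) c d d' z) :
    ∃ y, IsOutline e 1 c (fun i q => d i (κ q)) d' y := by
  have hrow : ∀ j i, ∑ k, z i j k = e i * d i j * #{q | κ q = j} := fun j i => by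
    rw [hz.sum_symbols]; ring
  obtain ⟨D, hDz, hDrow, hDcol⟩ := exists_refinement κ (fun j => fun i k => z i j k) _
    (fun _ => c) (fun j i => (hrow j i).le)
    (fun j k => (hz.sum_rows j k).trans_eq (mul_comm _ _))
  refine ⟨fun i q k => D q i k, fun i q => ?_, fun i k => ?_, fun q k => ?_⟩
  · rw [Pi.one_apply, mul_one]
    refine eq_of_le_of_sum_fiber_eq (u := fun j => e i * d i j) (fun q => hDrow q i)
      (fun j => ?_) q
    simp_rw [← hrow, ← hDz, sum_comm (t := univ)]
  · rw [← sum_fiberwise univ κ]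
    simpa only [hDz] using hz.sum_columns i k
  · rw [Pi.one_apply, one_mul]
    exact hDcol q k

end IsOutline

theorem exists_isOutline_card_fiber_iff [Fintype I] [Fintype J] [Fintype K] [Fintype R]
    [Fintype C] [Fintype S] [DecidableEq I] [DecidableEq J] [DecidableEq K] (ρ : R → I) (κ : C → J)
    (ς : S → K) (d : I → J → ℕ) (d' : I → K → ℕ) :
    (∃ z, IsOutline (fun i => #{r | ρ r = i}) (fun j => #{q | κ q = j}) (fun k => #{s | ς s = k})
      d d' z) ↔
    ∃ x, IsOutline 1 1 1 (fun r q => d (ρ r) (κ q)) (fun r s => d' (ρ r) (ς s)) x := by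
  constructor
  · rintro ⟨z, hz⟩
    obtain ⟨y, hy⟩ := hz.exists_splitRows
    obtain ⟨y', hy'⟩ := hy.exists_splitColumns
    obtain ⟨x, hx⟩ := hy'.swap.exists_splitColumns
    exact ⟨_, hx.swap⟩
  · rintro ⟨x, hx⟩
    have hy' := hx.mergeColumns (κ := κ) (d := fun r j => d (ρ r) j)
    have hy := (hy'.swap.mergeColumns (κ := ς) (d := fun r k => d' (ρ r) k)).swap
    exact ⟨_, hy.mergeRows⟩

end Outline

theorem sum_boole_eq_boole {ι : Type*} [Fintype ι] {p : ι → Prop} [DecidablePred p] {q : Prop}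
    [Decidable q] (hp : ∀ i, p i → q) (hq : q → ∃! i, p i) :
    ∑ i, (if p i then 1 else 0) = if q then 1 else 0 := by
  split_ifs with h
  · obtain ⟨i, hi, hunique⟩ := hq h
    rw [sum_boole, Nat.cast_id, card_eq_one]
    exact ⟨i, by ext j; simpa using ⟨hunique j, fun hj => hj ▸ hi⟩⟩
  · exact sum_eq_zero fun i _ => if_neg fun hi => h (hp i hi)

theorem of_sum_eq_boole {ι : Type*} [Fintype ι] {g : ι → ℕ} {q : Prop} [Decidable q]
    (h : ∑ i, g i = if q then 1 else 0) {i : ι} (hi : g i = 1) : q := by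
  by_contra hq
  rw [if_neg hq, sum_eq_zero_iff] at h
  exact one_ne_zero (hi.symm.trans (h i (mem_univ i)))

theorem eq_of_sum_le_one {ι : Type*} [Fintype ι] {g : ι → ℕ} (h : ∑ i, g i ≤ 1) {i j : ι}
    (hi : g i = 1) (hj : g j = 1) : i = j := by
  classical
  by_contra hne
  have hpair := (sum_le_univ_sum_of_nonneg (f := g) (s := {i, j}) fun _ => Nat.zero_le _).trans h
  rw [sum_pair hne, hi, hj] at hpair
  omega

theorem existsUnique_eq_one_of_sum_eq_one {ι : Type*} [Fintype ι] {g : ι → ℕ}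
    (h : ∑ i, g i = 1) : ∃! i, g i = 1 := by
  obtain ⟨i, -, hi⟩ := exists_ne_zero_of_sum_ne_zero (h.trans_ne one_ne_zero)
  have hle : g i ≤ 1 := h ▸ single_le_sum (fun _ _ => Nat.zero_le _) (mem_univ i)
  have hone : g i = 1 := by omega
  exact ⟨i, hone, fun j hj => eq_of_sum_le_one h.le hj hone⟩

section LatinArray

variable {R C S : Type*}

/-- A filling of the cells `P` of an array with symbols, where `X r c s` means that cell `(r, c)`
contains `s`, such that row `r` contains each symbol of `Q r` exactly once and no other symbol, and
no symbol is repeated in a column. Filling a Young diagram is the case where the first `ℓ` columns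
and the first `ℓ` symbols belong to a row of length `ℓ`. -/
structure IsLatinArray (P : R → C → Prop) (Q : R → S → Prop) (X : R → C → S → Prop) :
    Prop where
  cell : ∀ {r c s}, X r c s → P r c
  symbol : ∀ {r c s}, X r c s → Q r s
  existsUnique_symbol : ∀ {r c}, P r c → ∃! s, X r c s
  existsUnique_column : ∀ {r s}, Q r s → ∃! c, X r c s
  row_unique : ∀ {r r' c s}, X r c s → X r' c s → r = r'

variable [Fintype R] [Fintype C] [Fintype S] {P : R → C → Prop} {Q : R → S → Prop}
  [∀ r c, Decidable (P r c)] [∀ r s, Decidable (Q r s)]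

theorem IsLatinArray.isOutline {X : R → C → S → Prop} [∀ r c s, Decidable (X r c s)]
    (hX : IsLatinArray P Q X) :
    IsOutline 1 1 1 (fun r c => if P r c then 1 else 0) (fun r s => if Q r s then 1 else 0)
      fun r c s => if X r c s then 1 else 0 where
  sum_symbols r c := by
    simpa using sum_boole_eq_boole (fun s => hX.cell) (hX.existsUnique_symbol (r := r) (c := c))
  sum_columns r s := by
    simpa using sum_boole_eq_boole (fun c => hX.symbol) (hX.existsUnique_column (r := r) (s := s))
  sum_rows c s := by
    rw [sum_boole, Nat.cast_id, Pi.one_apply, Pi.one_apply, one_mul, card_le_one]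
    simpa only [mem_filter_univ] using fun r hr r' hr' => hX.row_unique hr hr'

theorem IsOutline.isLatinArray {x : R → C → S → ℕ}
    (hx : IsOutline 1 1 1 (fun r c => if P r c then 1 else 0)
      (fun r s => if Q r s then 1 else 0) x) :
    IsLatinArray P Q fun r c s => x r c s = 1 := by
  have hsymbols : ∀ r c, ∑ s, x r c s = if P r c then 1 else 0 := fun r c => by
    simpa using hx.sum_symbols r c
  have hcolumns : ∀ r s, ∑ c, x r c s = if Q r s then 1 else 0 := fun r s => by
    simpa using hx.sum_columns r s
  have hrows : ∀ c s, ∑ r, x r c s ≤ 1 := hx.sum_rows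
  exact
    { cell := of_sum_eq_boole (hsymbols _ _)
      symbol := of_sum_eq_boole (g := fun c => x _ c _) (hcolumns _ _)
      existsUnique_symbol := fun h =>
        existsUnique_eq_one_of_sum_eq_one ((hsymbols _ _).trans (if_pos h))
      existsUnique_column := fun h =>
        existsUnique_eq_one_of_sum_eq_one ((hcolumns _ _).trans (if_pos h))
      row_unique := eq_of_sum_le_one (g := fun r => x r _ _) (hrows _ _) }

theorem exists_isOutline_boole_iff :
    (∃ x, IsOutline 1 1 1 (fun r c => if P r c then 1 else 0)
      (fun r s => if Q r s then 1 else 0) x) ↔ ∃ X, IsLatinArray P Q X := by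
  classical
  exact ⟨fun ⟨_, hx⟩ => ⟨_, hx.isLatinArray⟩, fun ⟨_, hX⟩ => ⟨_, hX.isOutline⟩⟩

end LatinArray

section Filling

variable {w : List ℕ} {hw : w.SortedGE} {n : ℕ}

theorem mem_ofRowLens_iff (r : Fin w.length) (c : ℕ) :
    ((r : ℕ), c) ∈ YoungDiagram.ofRowLens w hw ↔ c < w[r] := by
  simp [YoungDiagram.mem_ofRowLens]

theorem IsLatinFilling.bijOn_row {f : ℕ → ℕ → ℕ}
    (hf : IsLatinFilling (YoungDiagram.ofRowLens w hw) f) (r : Fin w.length) :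
    Set.BijOn (f r) {c | c < w[r]} (Set.Icc 1 w[r]) := by
  simpa only [mem_ofRowLens_iff, YoungDiagram.rowLen_ofRowLens] using hf.row r

theorem IsLatinFilling.isLatinArray {f : ℕ → ℕ → ℕ}
    (hf : IsLatinFilling (YoungDiagram.ofRowLens w hw) f) (hn : ∀ r : Fin w.length, w[r] ≤ n) :
    IsLatinArray (fun (r : Fin w.length) (c : Fin n) => c < w[r]) (fun r (s : Fin n) => s < w[r])
      fun r c s => c < w[r] ∧ f r c = s + 1 where
  cell := And.left
  symbol {r c s} h := by
    have := (hf.bijOn_row r).mapsTo h.1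
    rw [h.2, Set.mem_Icc] at this
    omega
  existsUnique_symbol {r c} hc := by
    obtain ⟨hpos, hle⟩ := (hf.bijOn_row r).mapsTo hc
    have := hn r
    exact ⟨⟨f r c - 1, by omega⟩, ⟨hc, by simp only; omega⟩, fun s hs => Fin.ext (by simp [hs.2])⟩
  existsUnique_column {r s} hs := by
    obtain ⟨c, hc, hcs⟩ := (hf.bijOn_row r).surjOn (Set.mem_Icc.2 ⟨Nat.le_add_left 1 s, hs⟩)
    exact ⟨⟨c, hc.trans_le (hn r)⟩, ⟨hc, hcs⟩, fun c' hc' =>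
      Fin.ext ((hf.bijOn_row r).injOn hc'.1 hc (hc'.2.trans hcs.symm))⟩
  row_unique {r r' c s} h h' := Fin.ext <| hf.col c ((mem_ofRowLens_iff r c).2 h.1)
    ((mem_ofRowLens_iff r' c).2 h'.1) (h.2.trans h'.2.symm)

theorem IsLatinArray.exists_forall_eq_add_one {m : ℕ} {P Q : Fin m → Fin n → Prop}
    {X : Fin m → Fin n → Fin n → Prop} (hX : IsLatinArray P Q X) :
    ∃ f : ℕ → ℕ → ℕ, ∀ r c s, X r c s → f r c = s + 1 := by
  have hvalue : ∀ r c : ℕ, ∃ v : ℕ, ∀ (r' : Fin m) (c' s : Fin n),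
      (r' : ℕ) = r → (c' : ℕ) = c → X r' c' s → v = s + 1 := by
    intro r c
    by_cases h : ∃ (r' : Fin m) (c' s : Fin n), (r' : ℕ) = r ∧ (c' : ℕ) = c ∧ X r' c' s
    · obtain ⟨r', c', s, rfl, rfl, hs⟩ := h
      refine ⟨s + 1, fun r'' c'' s' hr hc hs' => ?_⟩
      obtain rfl := Fin.ext hr
      obtain rfl := Fin.ext hc
      rw [(hX.existsUnique_symbol (hX.cell hs)).unique hs hs']
    · exact ⟨0, fun r' c' s hr hc hs => absurd ⟨r', c', s, hr, hc, hs⟩ h⟩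
  choose f hf using hvalue
  exact ⟨f, fun r c s => hf r c r c s rfl rfl⟩

section OfArray

variable {X : Fin w.length → Fin n → Fin n → Prop}

theorem IsLatinArray.bijOn_row
    (hX : IsLatinArray (fun (r : Fin w.length) (c : Fin n) => (c : ℕ) < w[r])
      (fun r (s : Fin n) => (s : ℕ) < w[r]) X)
    (hn : ∀ r : Fin w.length, w[r] ≤ n) {f : ℕ → ℕ → ℕ} (hf : ∀ r c s, X r c s → f r c = s + 1)
    (r : Fin w.length) : Set.BijOn (f r) {c | c < w[r]} (Set.Icc 1 w[r]) := by
  have hcell : ∀ c, c < w[r] → ∃ (hc : c < n) (s : Fin n), X r ⟨c, hc⟩ s := fun c hc =>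
    ⟨hc.trans_le (hn r), (hX.existsUnique_symbol (c := ⟨c, hc.trans_le (hn r)⟩) hc).exists⟩
  refine ⟨fun c hc => ?_, fun c hc c' hc' h => ?_, fun v hv => ?_⟩
  · obtain ⟨hcn, s, hs⟩ := hcell c hc
    rw [hf r ⟨c, hcn⟩ s hs]
    exact ⟨Nat.le_add_left 1 s, hX.symbol hs⟩
  · obtain ⟨hcn, s, hs⟩ := hcell c hc
    obtain ⟨hcn', s', hs'⟩ := hcell c' hc'
    have hss' : s = s' := Fin.ext <| Nat.succ_injective <|
      (hf r ⟨c, hcn⟩ s hs).symm.trans (h.trans (hf r ⟨c', hcn'⟩ s' hs'))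
    subst hss'
    exact congrArg Fin.val ((hX.existsUnique_column (hX.symbol hs)).unique hs hs')
  · obtain ⟨hv_pos, hv_le⟩ := hv
    have hlt : v - 1 < w[r] := by omega
    obtain ⟨c, hc, -⟩ := hX.existsUnique_column (s := ⟨v - 1, hlt.trans_le (hn r)⟩) hlt
    exact ⟨c, hX.cell hc, (hf r c _ hc).trans (Nat.sub_add_cancel hv_pos)⟩

theorem IsLatinArray.isLatinFilling
    (hX : IsLatinArray (fun (r : Fin w.length) (c : Fin n) => (c : ℕ) < w[r])
      (fun r (s : Fin n) => (s : ℕ) < w[r]) X)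
    (hn : ∀ r : Fin w.length, w[r] ≤ n) {f : ℕ → ℕ → ℕ} (hf : ∀ r c s, X r c s → f r c = s + 1) :
    IsLatinFilling (YoungDiagram.ofRowLens w hw) f where
  row r := by
    by_cases hr : r < w.length
    · lift r to Fin w.length using hr
      simpa only [mem_ofRowLens_iff, YoungDiagram.rowLen_ofRowLens] using hX.bijOn_row hn hf r
    · have hempty : {c | (r, c) ∈ YoungDiagram.ofRowLens w hw} = ∅ :=
        Set.eq_empty_of_forall_notMem fun c hc => hr (YoungDiagram.mem_ofRowLens.1 hc).1
      have hrowLen : (YoungDiagram.ofRowLens w hw).rowLen r = 0 :=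
        Nat.eq_zero_of_not_pos fun h =>
          Set.eq_empty_iff_forall_notMem.1 hempty 0 (YoungDiagram.mem_iff_lt_rowLen.2 h)
      rw [hempty, hrowLen, Set.Icc_eq_empty (by decide)]
      exact Set.bijOn_empty _
  col c r hr r' hr' h := by
    obtain ⟨hrl, hc⟩ := YoungDiagram.mem_ofRowLens.1 hr
    obtain ⟨hrl', hc'⟩ := YoungDiagram.mem_ofRowLens.1 hr'
    have hcn : c < n := hc.trans_le (hn ⟨r, hrl⟩)
    obtain ⟨s, hs, -⟩ := hX.existsUnique_symbol (r := ⟨r, hrl⟩) (c := ⟨c, hcn⟩) hc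
    obtain ⟨s', hs', -⟩ := hX.existsUnique_symbol (r := ⟨r', hrl'⟩) (c := ⟨c, hcn⟩) hc'
    have hss' : s = s' := Fin.ext <| Nat.succ_injective <|
      (hf _ _ s hs).symm.trans (h.trans (hf _ _ s' hs'))
    subst hss'
    exact congrArg Fin.val (hX.row_unique hs hs')

end OfArray

theorem isLatin_ofRowLens_iff_exists_isLatinArray (hn : ∀ r : Fin w.length, w[r] ≤ n) :
    IsLatin (YoungDiagram.ofRowLens w hw) ↔
      ∃ X, IsLatinArray (fun (r : Fin w.length) (c : Fin n) => (c : ℕ) < w[r])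
        (fun r (s : Fin n) => (s : ℕ) < w[r]) X := by
  refine ⟨fun ⟨f, hf⟩ => ⟨_, hf.isLatinArray hn⟩, fun ⟨X, hX⟩ => ?_⟩
  obtain ⟨f, hf⟩ := hX.exists_forall_eq_add_one
  exact ⟨f, hX.isLatinFilling hn hf⟩

end Filling

section Blocks

variable (w : List ℕ)

/-- The index set `{1, …, p}` of the blocks of rows, columns and symbols of the Young diagram with
row lengths `w`. -/
abbrev Block : Type :=
  Icc 1 (numBlocks w)

variable {w}

theorem Block.one_le (i : Block w) : 1 ≤ (i : ℕ) :=
  (mem_Icc.1 i.2).1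

theorem Block.le_numBlocks (i : Block w) : (i : ℕ) ≤ numBlocks w :=
  (mem_Icc.1 i.2).2

theorem blockLen_succ {i : ℕ} (hi : i < (w.toFinset.sort (· ≤ ·)).length) :
    blockLen w (i + 1) = (w.toFinset.sort (· ≤ ·))[i] := by
  simp [blockLen, List.getElem?_eq_getElem hi]

theorem strictMonoOn_blockLen : StrictMonoOn (blockLen w) (Set.Icc 1 (numBlocks w)) := by
  intro i hi j hj hij
  obtain ⟨i, rfl⟩ := Nat.exists_eq_add_of_le' hi.1
  obtain ⟨j, rfl⟩ := Nat.exists_eq_add_of_le' hj.1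
  have hjlen : j < (w.toFinset.sort (· ≤ ·)).length := by simpa [numBlocks] using hj.2
  rw [blockLen_succ hjlen, blockLen_succ (by omega)]
  exact w.toFinset.sortedLT_sort.getElem_lt_getElem_of_lt (by omega)

theorem strictMono_blockLen : StrictMono fun i : Block w => blockLen w i :=
  fun i j hij => strictMonoOn_blockLen (mem_Icc.1 i.2) (mem_Icc.1 j.2) hij

theorem blockLen_le_blockLen {i j : ℕ} (hij : i ≤ j) (hj : j ≤ numBlocks w) :
    blockLen w i ≤ blockLen w j := by
  rcases Nat.eq_zero_or_pos i with rfl | hi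
  · exact Nat.zero_le _
  · exact strictMonoOn_blockLen.monotoneOn ⟨hi, hij.trans hj⟩ ⟨hi.trans_le hij, hj⟩ hij

theorem exists_blockLen_eq {l : ℕ} (hl : l ∈ w) : ∃ i : Block w, blockLen w i = l := by
  obtain ⟨i, hi, rfl⟩ := List.getElem_of_mem ((mem_sort (· ≤ ·)).2 (List.mem_toFinset.2 hl))
  have hi' : i + 1 ≤ numBlocks w := by simpa [numBlocks] using hi
  exact ⟨⟨i + 1, mem_Icc.2 ⟨Nat.le_add_left 1 i, hi'⟩⟩, blockLen_succ hi⟩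

theorem exists_block_le_iff_lt_blockLen {c : ℕ} (hc : c < blockLen w (numBlocks w)) :
    ∃ i : Block w, ∀ j ≤ numBlocks w, (i : ℕ) ≤ j ↔ c < blockLen w j := by
  classical
  have hex : ∃ i, c < blockLen w i := ⟨_, hc⟩
  have hpos : 0 < Nat.find hex := (Nat.find_pos hex).2 (Nat.not_lt_zero c)
  exact ⟨⟨Nat.find hex, mem_Icc.2 ⟨hpos, Nat.find_min' hex hc⟩⟩, fun j hj =>
    ⟨fun hle => (Nat.find_spec hex).trans_le (blockLen_le_blockLen hle hj), Nat.find_min' hex⟩⟩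

/-- The block containing row `r`: the index `i` with `a i = w[r]`. -/
noncomputable def rowBlock (r : Fin w.length) : Block w :=
  (exists_blockLen_eq (w.getElem_mem r.2)).choose

theorem blockLen_rowBlock (r : Fin w.length) : blockLen w (rowBlock r) = w[r] :=
  (exists_blockLen_eq (w.getElem_mem r.2)).choose_spec

/-- The block containing column `c`: the index `j` with `a (j - 1) ≤ c < a j`. The same blocks serve
for the symbols, the number `s + 1` lying in the block of `s`. -/
noncomputable def colBlock (c : Fin (blockLen w (numBlocks w))) : Block w :=
  (exists_block_le_iff_lt_blockLen c.2).choose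

theorem colBlock_le_iff (c : Fin (blockLen w (numBlocks w))) {j : ℕ} (hj : j ≤ numBlocks w) :
    (colBlock c : ℕ) ≤ j ↔ c < blockLen w j :=
  (exists_block_le_iff_lt_blockLen c.2).choose_spec j hj

theorem colBlock_eq_iff (c : Fin (blockLen w (numBlocks w))) (j : Block w) :
    colBlock c = j ↔ blockLen w (j - 1) ≤ c ∧ c < blockLen w j := by
  have hle := colBlock_le_iff c j.le_numBlocks
  have hpred := colBlock_le_iff c ((Nat.sub_le j 1).trans j.le_numBlocks)
  have hj := j.one_le
  rw [← hle, ← not_lt, ← hpred, Subtype.ext_iff]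
  omega

theorem colBlock_le_rowBlock_iff (r : Fin w.length) (c : Fin (blockLen w (numBlocks w))) :
    colBlock c ≤ rowBlock r ↔ c < w[r] := by
  rw [← blockLen_rowBlock]
  exact colBlock_le_iff c (rowBlock r).le_numBlocks

theorem getElem_le_blockLen_numBlocks (r : Fin w.length) : w[r] ≤ blockLen w (numBlocks w) := by
  rw [← blockLen_rowBlock]
  exact blockLen_le_blockLen (rowBlock r).le_numBlocks le_rfl

theorem card_rowBlock_eq (i : Block w) : #{r | rowBlock r = i} = blockHeight w i := by
  simp_rw [← strictMono_blockLen.injective.eq_iff, blockLen_rowBlock, blockHeight]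
  generalize blockLen w i = l
  conv_rhs => rw [← List.ofFn_getElem (xs := w)]
  rw [← Multiset.coe_count, ← Fin.univ_val_map, Multiset.count_map, Finset.card]
  simp [eq_comm]

theorem card_colBlock_eq (j : Block w) : #{c | colBlock c = j} = blockWidth w j := by
  rw [blockWidth, ← Nat.card_Ico, ← card_map Fin.valEmbedding]
  congr 1
  ext c
  simp only [mem_map, mem_filter_univ, colBlock_eq_iff, Fin.valEmbedding_apply, mem_Ico]
  refine ⟨fun ⟨_, hc, h⟩ => h ▸ hc, fun hc => ⟨⟨c, ?_⟩, hc, rfl⟩⟩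
  exact hc.2.trans_le (blockLen_le_blockLen j.le_numBlocks le_rfl)

end Blocks

section Allocation

variable {w : List ℕ} {z : ℕ → ℕ → ℕ → ℕ}

theorem sum_block_eq_sum_Icc {m n : ℕ} (hm : 1 ≤ m) (hn : n ≤ numBlocks w) {f : ℕ → ℕ}
    (hf : ∀ i : Block w, ¬(m ≤ i ∧ i ≤ n) → f i = 0) : ∑ i : Block w, f i = ∑ i ∈ Icc m n, f i := by
  rw [sum_coe_sort (Icc 1 (numBlocks w)) f]
  exact (sum_subset (Icc_subset_Icc hm hn) fun i hi hmn =>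
    hf ⟨i, hi⟩ (by simpa using hmn)).symm

theorem isAllocation_iff_isOutline (hz : ∀ i j k, ¬(j ≤ i ∧ k ≤ i) → z i j k = 0) :
    IsAllocation w z ↔ IsOutline (fun i : Block w => blockHeight w i)
      (fun j : Block w => blockWidth w j) (fun k : Block w => blockWidth w k)
      (fun i j => if j ≤ i then 1 else 0) (fun i k => if k ≤ i then 1 else 0)
      fun i j k => z i j k := by
  have hsymbols (i : Block w) (j : ℕ) : ∑ k : Block w, z i j k = ∑ k ∈ Icc 1 (i : ℕ), z i j k :=
    sum_block_eq_sum_Icc le_rfl i.le_numBlocks fun k hk =>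
      hz i j k fun h => hk ⟨k.one_le, h.2⟩
  have hcolumns (i : Block w) (k : ℕ) : ∑ j : Block w, z i j k = ∑ j ∈ Icc 1 (i : ℕ), z i j k :=
    sum_block_eq_sum_Icc (f := fun j => z i j k) le_rfl i.le_numBlocks fun j hj =>
      hz i j k fun h => hj ⟨j.one_le, h.1⟩
  have hrows (j k : Block w) :
      ∑ i : Block w, z i j k = ∑ i ∈ Icc (max (j : ℕ) k) (numBlocks w), z i j k :=
    sum_block_eq_sum_Icc (f := fun i => z i j k) (le_max_of_le_left j.one_le) le_rfl fun i hi =>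
      hz i j k fun h => hi ⟨max_le h.1 h.2, i.le_numBlocks⟩
  constructor
  · intro h
    refine ⟨fun i j => ?_, fun i k => ?_, fun j k => ?_⟩
    · split_ifs with hji
      · rw [hsymbols, mul_one, h.sum_symbols i j j.one_le hji i.le_numBlocks]
      · exact sum_eq_zero fun k _ => hz i j k fun h => hji h.1
    · split_ifs with hki
      · rw [hcolumns, mul_one, h.sum_columns i k k.one_le hki i.le_numBlocks]
      · exact sum_eq_zero fun j _ => hz i j k fun h => hki h.2
    · rw [hrows]
      exact h.sum_rows j k j.one_le j.le_numBlocks k.one_le k.le_numBlocks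
  · intro h
    refine ⟨fun i j hj hji hi => ?_, fun i k hk hki hi => ?_, fun j k hj hj' hk hk' => ?_⟩
    · lift i to Block w using mem_Icc.2 ⟨hj.trans hji, hi⟩
      lift j to Block w using mem_Icc.2 ⟨hj, hji.trans hi⟩
      rw [← hsymbols, h.sum_symbols, if_pos (show j ≤ i from hji), mul_one]
    · lift i to Block w using mem_Icc.2 ⟨hk.trans hki, hi⟩
      lift k to Block w using mem_Icc.2 ⟨hk, hki.trans hi⟩
      rw [← hcolumns, h.sum_columns, if_pos (show k ≤ i from hki), mul_one]
    · lift j to Block w using mem_Icc.2 ⟨hj, hj'⟩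
      lift k to Block w using mem_Icc.2 ⟨hk, hk'⟩
      rw [← hrows]
      exact h.sum_rows j k

theorem IsAllocation.truncate (hz : IsAllocation w z) :
    IsAllocation w fun i j k => if j ≤ i ∧ k ≤ i then z i j k else 0 where
  sum_symbols i j hj hji hi := by
    rw [← hz.sum_symbols i j hj hji hi]
    exact sum_congr rfl fun k hk => if_pos ⟨hji, (mem_Icc.1 hk).2⟩
  sum_columns i k hk hki hi := by
    rw [← hz.sum_columns i k hk hki hi]
    exact sum_congr rfl fun j hj => if_pos ⟨(mem_Icc.1 hj).2, hki⟩
  sum_rows j k hj hj' hk hk' := by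
    refine (sum_le_sum fun i _ => ?_).trans (hz.sum_rows j k hj hj' hk hk')
    split_ifs
    exacts [le_rfl, Nat.zero_le _]

theorem exists_forall_block_eq (y : Block w → Block w → Block w → ℕ)
    (hy : ∀ i j k, ¬(j ≤ i ∧ k ≤ i) → y i j k = 0) :
    ∃ z : ℕ → ℕ → ℕ → ℕ, (∀ i j k : Block w, z i j k = y i j k) ∧
      ∀ i j k, ¬(j ≤ i ∧ k ≤ i) → z i j k = 0 := by
  refine ⟨fun i j k =>
    if h : i ∈ Icc 1 (numBlocks w) ∧ j ∈ Icc 1 (numBlocks w) ∧ k ∈ Icc 1 (numBlocks w) then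
      y ⟨i, h.1⟩ ⟨j, h.2.1⟩ ⟨k, h.2.2⟩ else 0, fun i j k => dif_pos ⟨i.2, j.2, k.2⟩,
    fun i j k h => ?_⟩
  dsimp only
  split_ifs
  exacts [hy _ _ _ h, rfl]

theorem hasAllocation_iff_exists_isOutline :
    HasAllocation w ↔ ∃ y, IsOutline (fun i : Block w => blockHeight w i)
      (fun j : Block w => blockWidth w j) (fun k : Block w => blockWidth w k)
      (fun i j => if j ≤ i then 1 else 0) (fun i k => if k ≤ i then 1 else 0) y := by
  constructor
  · rintro ⟨z, hz⟩
    exact ⟨_, (isAllocation_iff_isOutline fun i j k h => if_neg h).1 hz.truncate⟩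
  · rintro ⟨y, hy⟩
    obtain ⟨z, hzy, hz⟩ := exists_forall_block_eq y fun i j k h => by
      rcases not_and_or.1 h with h | h
      · exact hy.eq_zero_of_column_eq_zero (if_neg h) k
      · exact hy.eq_zero_of_symbol_eq_zero (if_neg h) j
    refine ⟨z, (isAllocation_iff_isOutline hz).2 ?_⟩
    simpa only [hzy] using hy

end Allocation

theorem mainTheorem2 (w : List ℕ) (hw : w.SortedGE) :
    HasAllocation w ↔ IsLatin (YoungDiagram.ofRowLens w hw) := by
  rw [hasAllocation_iff_exists_isOutline]
  simp_rw [← card_rowBlock_eq, ← card_colBlock_eq]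
  rw [exists_isOutline_card_fiber_iff, exists_isOutline_boole_iff,
    isLatin_ofRowLens_iff_exists_isLatinArray getElem_le_blockLen_numBlocks]
  simp_rw [colBlock_le_rowBlock_iff]
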